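/- Throughout, $z$ lies in the upper half-plane $\mathfrak{h}$, $q=\exp(2\pi i z)$, rational powers of $q$ mean $q^{r}=\exp(2\pi i r z)$, $(a;x)_\infty=\prod_{n\ge 0}(1-a x^n)$, and $\eta(z)=q^{1/24}\prod_{n\ge1}(1-q^n)$. For $N\ge 1$ and $N\nmid\rho$, Biagioli's theta product is $$f_{N,\rho}(z)=q^{(N-2\rho)^2/(8N)}\,(q^{\rho};q^N)_\infty\,(q^{N-\rho};q^N)_\infty\,(q^{N};q^N)_\infty .$$ For $A=\begin{pmatrix}a&b\\c&d\end{pmatrix}\in \mathrm{SL}_2(\mathbb{Z})$ the weight-$1$ stroke operator is $(F\,|\,[A]_1)(z)=(cz+d)^{-1}F\!\left(\frac{az+b}{cz+d}\right)$. Let $p>3$ be prime, let $m\in\mathbb{Z}$, let $\vec n=(n_0,n_1,\dots,n_{\frac12(p-1)})\in\mathbb{Z}^{\frac12(p+1)}$, and put $$j(z)=j(p,\vec n,z)=\eta(pz)^{n_0}\prod_{k=1}^{\frac12(p-1)}f_{p,k}(z)^{n_k}.$$ Suppose that 1. $n_0+\sum_{k=1}^{\frac12(p-1)}n_k=2$,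 2. $\sum_{k=1}^{\frac12(p-1)}k^2n_k\equiv 2m \pmod p$, 3. $n_0+3\sum_{k=1}^{\frac12(p-1)}n_k\equiv 0\pmod{24}$. Then $j$ is a weakly holomorphic modular form of weight $1$ on $\Gamma(p)$, that is, $j$ is holomorphic on $\mathfrak{h}$, satisfies $j\,|\,[A]_1=j$ for all $A\in\Gamma(p)$, and is meromorphic at every cusp. Moreover, for every $A=\begin{pmatrix}a&b\\c&d\end{pmatrix}\in\Gamma_1(p)$, $$j\,|\,[A]_1=\exp\!\left(\frac{2\pi i b m}{p}\right) j .$$ -/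

import Mathlib

open UpperHalfPlane
open scoped MatrixGroups ModularForm Manifold

/-- The infinite `x`-Pochhammer symbol `(a; x)_∞ = ∏_{n ≥ 0} (1 - a x ^ n)`. -/
noncomputable def qPochhammerInf (a x : ℂ) : ℂ :=
  ∏' n : ℕ, (1 - a * x ^ n)

/-- Biagioli's theta product
`f_{N,ρ}(z) = q ^ ((N - 2ρ)² / (8N)) (q ^ ρ; q ^ N)_∞ (q ^ (N - ρ); q ^ N)_∞ (q ^ N; q ^ N)_∞`,
where `q = exp (2πiz)`, and the fractional power of `q` means
`exp (2πiz (N - 2ρ)² / (8N))`. -/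
noncomputable def biagioliTheta (N : ℕ) (ρ : ℤ) (z : ℍ) : ℂ :=
  let q : ℂ := Complex.exp (2 * Real.pi * Complex.I * (z : ℂ))
  Complex.exp (2 * Real.pi * Complex.I * (z : ℂ) * (((N : ℂ) - 2 * (ρ : ℂ)) ^ 2 / (8 * (N : ℂ)))) *
    (qPochhammerInf (q ^ ρ) (q ^ N) *
      qPochhammerInf (q ^ ((N : ℤ) - ρ)) (q ^ N) *
      qPochhammerInf (q ^ N) (q ^ N))

/-- The generalized eta-quotient
`j(p, n, z) = η(pz) ^ n₀ ∏_{k = 1}^{(p-1)/2} f_{p,k}(z) ^ n_k`.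
Only the entries `n 0, …, n ((p-1)/2)` of `n` are used. -/
noncomputable def etaThetaQuotient (p : ℕ) (n : ℕ → ℤ) (z : ℍ) : ℂ :=
  ModularForm.eta ((p : ℂ) * (z : ℂ)) ^ (n 0) *
    ∏ k ∈ Finset.Icc 1 ((p - 1) / 2), biagioliTheta p (k : ℤ) z ^ (n k)

/-- `f` is a weakly holomorphic modular form of weight `k` on the finite-index subgroup `Γ` of
`SL(2, ℤ)`: it is holomorphic on the upper half-plane, invariant under the weight `k` stroke
operators of the elements of `Γ`, and meromorphic at every cusp. The cusps are the points `γ ∞`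
with `γ` in `SL(2, ℤ)`. If `γ T ^ h γ⁻¹` lies in `Γ`, where `h ≥ 1` and `T` is the translation by
one, then `f ∣[k] γ` has period `h`, so it is a function of `exp (2πiz / h)` on the punctured unit
disc; `f` is meromorphic at the cusp `γ ∞` when this function is meromorphic at `0`. -/
structure IsWeaklyHolomorphicModularForm (k : ℤ) (Γ : Subgroup SL(2, ℤ)) (f : ℍ → ℂ) : Prop where
  holo : MDifferentiable 𝓘(ℂ) 𝓘(ℂ) f
  slash_eq : ∀ γ ∈ Γ, f ∣[k] γ = f
  meromorphic_at_cusps : ∀ γ : SL(2, ℤ), ∃ h : ℕ, 0 < h ∧ γ * ModularGroup.T ^ h * γ⁻¹ ∈ Γ ∧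
    MeromorphicAt (UpperHalfPlane.cuspFunction (h : ℝ) (f ∣[k] γ)) 0

/-!
The quotient `j` is, up to sign, a product of Klein forms and a power of the discriminant, both of
which transform without multiplier system under all of `SL(2, ℤ)`.

Put `τ = p z`. For `a` in `ℝ²` the Klein form is `𝔨_a(τ) = exp (πi a₀ u) θ(u, τ)` at
`u = a₀ τ + a₁`, with `θ` the odd product `thetaProduct`. Comparing products gives
`f_{p,k}(z) = -η(τ)³ 𝔨_{(k/p, 0)}(τ)` (`biagioliTheta_eq_kleinForm`), so that the exponent of `η(τ)`
in `j` becomes `n₀ + 3 ∑ nₖ = 24 l`, and `j = ± Δ(τ) ^ l ∏ 𝔨_{(k/p, 0)}(τ) ^ nₖ`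
(`etaThetaQuotient_eq_kleinProduct`).

The Klein forms satisfy `𝔨_a ∣[-1] γ = 𝔨_{aγ}` (`kleinForm_slash`). This need only be checked for
the generators `S` and `T`, and the case of `S` is the inversion formula `thetaProduct_S_smul`.
There, both sides have the same zeros and quasi-periods as functions of `u`, so their quotient is an
elliptic function without poles, hence constant, and it equals `1` at the origin. Moreover
`𝔨_{a+b}` is an explicit constant of absolute value `1` times `𝔨_a` when `b` is integral
(`kleinForm_add_int`).

For `A = (a, b; c, d)` in `Γ₁(p)` one has `p (A z) = A' τ` with `A' = (a, pb; c/p, d)`, and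
`(k/p, 0) A'` differs from `(k/p, 0)` by an integral vector. The constants so obtained multiply
up to `exp (2πi b m / p)` by the congruence on `∑ k² nₖ` (`prod_kleinForm_multipliers`). The weight
is `12 l - ∑ nₖ = 1`.

At a cusp `γ ∞`, write `diag(p, 1) γ = γ' (α, β; 0, δ)` with `γ'` in `SL(2, ℤ)`. Then `j ∣[1] γ` is
a constant times the product of `Δ ^ l` and the `𝔨_{(k/p, 0)γ'} ^ nₖ` at `(α z + β) / δ`
(`etaThetaQuotient_slash`). Each factor has exact exponential growth in `Im z`, by inspection of the
leading factor of its product, so a power of the local parameter times `j ∣[1] γ` is bounded, and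
the singularity of that product is removable (`meromorphicAt_cuspFunction`).
-/

open Filter Topology Complex

/-! ### The infinite Pochhammer symbol -/

lemma summable_norm_mul_pow {a x : ℂ} (hx : ‖x‖ < 1) : Summable fun n : ℕ ↦ ‖-(a * x ^ n)‖ := by
  simpa using (summable_geometric_of_lt_one (norm_nonneg x) hx).mul_left ‖a‖

lemma qPochhammerInf_eq_tprod_one_add (a x : ℂ) :
    qPochhammerInf a x = ∏' n : ℕ, (1 + -(a * x ^ n)) := by
  simp only [qPochhammerInf, sub_eq_add_neg]

lemma qPochhammerInf_eq_mul {a x : ℂ} (hx : ‖x‖ < 1) :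
    qPochhammerInf a x = (1 - a) * qPochhammerInf (a * x) x := by
  have hm (b : ℂ) : Multipliable fun n : ℕ ↦ (1 - b * x ^ n) := by
    simpa only [sub_eq_add_neg] using
      multipliable_one_add_of_summable (summable_norm_mul_pow (a := b) hx)
  have h := hm (a * x)
  rw [qPochhammerInf, qPochhammerInf, tprod_eq_zero_mul']
  · simp [pow_succ', mul_assoc]
  · simpa [pow_succ', mul_assoc] using h

lemma qPochhammerInf_ne_zero {a x : ℂ} (hx : ‖x‖ < 1) (h : ∀ n : ℕ, a * x ^ n ≠ 1) :
    qPochhammerInf a x ≠ 0 := by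
  rw [qPochhammerInf_eq_tprod_one_add]
  refine tprod_one_add_ne_zero_of_summable (fun n ↦ ?_) (summable_norm_mul_pow hx)
  rw [← sub_eq_add_neg, sub_ne_zero]
  exact (h n).symm

/-- The Pochhammer symbol is holomorphic in both arguments jointly: on a small neighbourhood its
factors are bounded by a geometric series. -/
lemma DifferentiableOn.qPochhammerInf {U : Set ℂ} (hU : IsOpen U) {g h : ℂ → ℂ}
    (hg : DifferentiableOn ℂ g U) (hh : DifferentiableOn ℂ h U) (hlt : ∀ z ∈ U, ‖h z‖ < 1) :
    DifferentiableOn ℂ (fun z ↦ qPochhammerInf (g z) (h z)) U := by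
  intro z₀ hz₀
  obtain ⟨r, hr, hr1⟩ := exists_between (hlt z₀ hz₀)
  have hr0 : 0 ≤ r := (norm_nonneg _).trans hr.le
  set M := ‖g z₀‖ + 1
  have hV1 : ∀ᶠ z in 𝓝 z₀, ‖g z‖ < M :=
    (hg.continuousOn.continuousAt (hU.mem_nhds hz₀)).norm.eventually_lt_const (by simp [M])
  have hV2 : ∀ᶠ z in 𝓝 z₀, ‖h z‖ < r :=
    (hh.continuousOn.continuousAt (hU.mem_nhds hz₀)).norm.eventually_lt_const hr
  obtain ⟨V, hV, hVo, hzV⟩ := eventually_nhds_iff.mp (hV1.and (hV2.and (hU.mem_nhds hz₀)))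
  have hgV : DifferentiableOn ℂ g V := hg.mono fun z hz ↦ (hV z hz).2.2
  have hhV : DifferentiableOn ℂ h V := hh.mono fun z hz ↦ (hV z hz).2.2
  have key : HasProdLocallyUniformlyOn (fun (n : ℕ) z ↦ 1 + -(g z * h z ^ n))
      (fun z ↦ ∏' n : ℕ, (1 + -(g z * h z ^ n))) V := by
    refine Summable.hasProdLocallyUniformlyOn_nat_one_add hVo
      ((summable_geometric_of_lt_one hr0 hr1).mul_left M) (.of_forall fun n z hz ↦ ?_) fun n ↦
      ((hgV.continuousOn.mul (hhV.continuousOn.pow n)).neg)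
    rw [norm_neg, norm_mul, norm_pow]
    exact mul_le_mul (hV z hz).1.le (pow_le_pow_left₀ (norm_nonneg _) (hV z hz).2.1.le n)
      (by positivity) (by positivity)
  have hd := key.differentiableOn (.of_forall fun s ↦ by
    simpa [Finset.prod_fn] using DifferentiableOn.finsetProd
      (fun n _ ↦ ((hgV.mul (hhV.pow n)).neg.const_add 1))) hVo
  simp only [← qPochhammerInf_eq_tprod_one_add] at hd
  exact (hd.differentiableAt (hVo.mem_nhds hzV)).differentiableWithinAt

lemma Filter.Tendsto.qPochhammerInf_one {α : Type*} {l : Filter α} {g h : α → ℂ}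
    (hg : Tendsto g l (𝓝 0)) (hh : Tendsto h l (𝓝 0)) :
    Tendsto (fun t ↦ qPochhammerInf (g t) (h t)) l (𝓝 1) := by
  have := tendsto_tprod_one_add_of_dominated_convergence (𝓕 := l) (g := 0)
      (f := fun t (n : ℕ) ↦ -(g t * h t ^ n)) (bound := fun n ↦ (1 / 2 : ℝ) ^ n)
  simp only [Pi.zero_apply, norm_neg, norm_pow, norm_mul, add_zero, tprod_one] at this
  simp_rw [qPochhammerInf_eq_tprod_one_add]
  refine this (summable_geometric_of_lt_one (by norm_num) (by norm_num)) (fun k ↦ ?_) ?_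
  · simpa using (hg.mul (hh.pow k)).neg
  · have h1 : ∀ᶠ t in l, ‖g t‖ < 1 := hg.norm.eventually_lt_const (by simp)
    have h2 : ∀ᶠ t in l, ‖h t‖ < 1 / 2 := hh.norm.eventually_lt_const (by simp)
    filter_upwards [h1, h2] with t ht1 ht2 k
    calc ‖g t‖ * ‖h t‖ ^ k ≤ 1 * (1 / 2) ^ k := by gcongr
      _ = _ := one_mul _

/-! ### The odd theta product -/

/-- The product `(w^{1/2} - w^{-1/2}) ∏_{n ≥ 1} (1 - Q^n w) (1 - Q^n w⁻¹) (1 - Q^n)⁻²`, where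
`Q = exp (2πiτ)` and `w = exp (2πiz)`. It is an entire odd function of `z` with simple zeros at the
points of `ℤτ + ℤ` and derivative `2πi` at the origin. -/
noncomputable def thetaProduct (τ : ℍ) (z : ℂ) : ℂ :=
  (cexp (Real.pi * Complex.I * z) - cexp (-(Real.pi * Complex.I * z))) *
    (qPochhammerInf (cexp (2 * Real.pi * Complex.I * (τ + z)))
        (cexp (2 * Real.pi * Complex.I * τ)) *
      qPochhammerInf (cexp (2 * Real.pi * Complex.I * (τ - z)))
        (cexp (2 * Real.pi * Complex.I * τ))) /
    qPochhammerInf (cexp (2 * Real.pi * Complex.I * τ)) (cexp (2 * Real.pi * Complex.I * τ)) ^ 2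

lemma norm_nome_lt_one (τ : ℍ) : ‖cexp (2 * Real.pi * Complex.I * τ)‖ < 1 :=
  norm_exp_two_pi_I_lt_one τ

lemma qPochhammerInf_nome_ne_zero (τ : ℍ) :
    qPochhammerInf (cexp (2 * Real.pi * Complex.I * τ))
      (cexp (2 * Real.pi * Complex.I * τ)) ≠ 0 := by
  have hq := norm_nome_lt_one τ
  refine qPochhammerInf_ne_zero hq fun n h ↦ ?_
  have := congrArg norm h
  rw [← pow_succ', norm_pow, norm_one] at this
  exact absurd this (pow_lt_one₀ (norm_nonneg _) hq n.succ_ne_zero).ne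

lemma differentiable_qPochhammerInf {g : ℂ → ℂ} (hg : Differentiable ℂ g) {x : ℂ} (hx : ‖x‖ < 1) :
    Differentiable ℂ fun z ↦ qPochhammerInf (g z) x :=
  differentiableOn_univ.mp <| DifferentiableOn.qPochhammerInf isOpen_univ hg.differentiableOn
    (differentiableOn_const x) fun _ _ ↦ hx

lemma differentiable_thetaProduct (τ : ℍ) : Differentiable ℂ (thetaProduct τ) := by
  have hq := norm_nome_lt_one τ
  exact ((by fun_prop : Differentiable ℂ fun z : ℂ ↦
      cexp (Real.pi * Complex.I * z) - cexp (-(Real.pi * Complex.I * z))).mul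
    ((differentiable_qPochhammerInf (by fun_prop) hq).mul
      (differentiable_qPochhammerInf (by fun_prop) hq))).div_const _

@[simp] lemma thetaProduct_zero (τ : ℍ) : thetaProduct τ 0 = 0 := by simp [thetaProduct]

lemma hasDerivAt_thetaProduct_zero (τ : ℍ) :
    HasDerivAt (thetaProduct τ) (2 * Real.pi * Complex.I) 0 := by
  have hq := norm_nome_lt_one τ
  have hB := ((differentiable_qPochhammerInf
    (g := fun z ↦ cexp (2 * Real.pi * Complex.I * (τ + z))) (by fun_prop) hq).mul
      (differentiable_qPochhammerInf
    (g := fun z ↦ cexp (2 * Real.pi * Complex.I * (τ - z))) (by fun_prop) hq)) 0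
  have hA : HasDerivAt
      (fun z : ℂ ↦ cexp (Real.pi * Complex.I * z) - cexp (-(Real.pi * Complex.I * z)))
      (2 * Real.pi * Complex.I) 0 := by
    have h1 : HasDerivAt (fun z : ℂ ↦ Real.pi * Complex.I * z) (Real.pi * Complex.I) 0 := by
      simpa using (hasDerivAt_id (0 : ℂ)).const_mul (Real.pi * Complex.I)
    convert! h1.cexp.sub h1.neg.cexp using 1
    simp
    ring
  have h := (hA.mul hB.hasDerivAt).div_const
    (qPochhammerInf (cexp (2 * Real.pi * Complex.I * τ)) (cexp (2 * Real.pi * Complex.I * τ)) ^ 2)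
  have h0 := qPochhammerInf_nome_ne_zero τ
  convert! h using 1
  simp
  field_simp

lemma thetaProduct_add_one (τ : ℍ) (z : ℂ) : thetaProduct τ (z + 1) = -thetaProduct τ z := by
  have e1 : cexp (Real.pi * Complex.I * (z + 1)) = -cexp (Real.pi * Complex.I * z) := by
    rw [mul_add, mul_one, Complex.exp_add, exp_pi_mul_I]; ring
  have e2 : cexp (-(Real.pi * Complex.I * (z + 1))) = -cexp (-(Real.pi * Complex.I * z)) := by
    rw [Complex.exp_neg, e1, Complex.exp_neg, inv_neg]
  have e3 : cexp (2 * Real.pi * Complex.I * (τ + (z + 1))) =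
      cexp (2 * Real.pi * Complex.I * (τ + z)) := by
    rw [← Complex.exp_periodic (2 * Real.pi * Complex.I * (τ + z))]; ring_nf
  have e4 : cexp (2 * Real.pi * Complex.I * (τ - (z + 1))) =
      cexp (2 * Real.pi * Complex.I * (τ - z)) := by
    rw [← Complex.exp_periodic (2 * Real.pi * Complex.I * (τ - (z + 1)))]; ring_nf
  simp only [thetaProduct, e1, e2, e3, e4]
  ring

lemma thetaProduct_add_tau (τ : ℍ) (z : ℂ) :
    thetaProduct τ (z + τ) = -cexp (-(Real.pi * Complex.I * (τ + 2 * z))) * thetaProduct τ z := by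
  have hq := norm_nome_lt_one τ
  have e1 := qPochhammerInf_eq_mul (a := cexp (2 * Real.pi * Complex.I * (τ + z))) hq
  have e2 := qPochhammerInf_eq_mul (a := cexp (2 * Real.pi * Complex.I * (τ - (z + τ)))) hq
  rw [← Complex.exp_add, show 2 * Real.pi * Complex.I * (τ + z) + 2 * Real.pi * Complex.I * τ =
    2 * Real.pi * Complex.I * (τ + (z + τ)) by ring] at e1
  rw [← Complex.exp_add, show
    2 * Real.pi * Complex.I * (τ - (z + τ)) + 2 * Real.pi * Complex.I * τ =
    2 * Real.pi * Complex.I * (τ - z) by ring] at e2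
  have e3 : cexp (Real.pi * Complex.I * (z + τ)) - cexp (-(Real.pi * Complex.I * (z + τ))) =
      -cexp (-(Real.pi * Complex.I * (z + τ))) *
        (1 - cexp (2 * Real.pi * Complex.I * (τ + z))) := by
    rw [mul_sub, neg_mul, neg_mul, ← Complex.exp_add]; ring_nf
  have e4 : cexp (-(Real.pi * Complex.I * (z + τ))) *
      (1 - cexp (2 * Real.pi * Complex.I * (τ - (z + τ)))) =
      cexp (-(Real.pi * Complex.I * (τ + 2 * z))) *
        (cexp (Real.pi * Complex.I * z) - cexp (-(Real.pi * Complex.I * z))) := by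
    simp only [mul_sub, mul_one, ← Complex.exp_add]; ring_nf
  simp only [thetaProduct, e3, e2]
  rw [e1]
  linear_combination -(1 - cexp (2 * Real.pi * Complex.I * (τ + z))) *
    qPochhammerInf (cexp (2 * Real.pi * Complex.I * (τ + (z + τ))))
      (cexp (2 * Real.pi * Complex.I * τ)) *
    qPochhammerInf (cexp (2 * Real.pi * Complex.I * (τ - z))) (cexp (2 * Real.pi * Complex.I * τ)) /
    qPochhammerInf (cexp (2 * Real.pi * Complex.I * τ))
      (cexp (2 * Real.pi * Complex.I * τ)) ^ 2 * e4

lemma exists_int_of_thetaProduct_eq_zero {τ : ℍ} {z : ℂ} (h : thetaProduct τ z = 0) :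
    ∃ m n : ℤ, z = m * τ + n := by
  have hq := norm_nome_lt_one τ
  have hpi : (2 * Real.pi * Complex.I : ℂ) ≠ 0 := two_pi_I_ne_zero
  by_contra! hz
  have aux (u : ℂ) (hu : ∀ m n : ℤ, u ≠ m * τ + n) : cexp (2 * Real.pi * Complex.I * u) ≠ 1 := by
    intro h1
    obtain ⟨n, hn⟩ := Complex.exp_eq_one_iff.mp h1
    refine hu 0 n ?_
    have : (2 * Real.pi * Complex.I : ℂ) * u = 2 * Real.pi * Complex.I * n := by rw [hn]; ring
    simpa using mul_left_cancel₀ hpi this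
  refine absurd h (div_ne_zero (mul_ne_zero ?_ (mul_ne_zero ?_ ?_))
    (pow_ne_zero 2 (qPochhammerInf_nome_ne_zero τ)))
  · intro h0
    refine aux z hz ?_
    have h1 : cexp (Real.pi * Complex.I * z) = cexp (-(Real.pi * Complex.I * z)) :=
      sub_eq_zero.mp h0
    rw [show 2 * Real.pi * Complex.I * z = Real.pi * Complex.I * z + Real.pi * Complex.I * z by ring,
      Complex.exp_add]
    nth_rw 1 [h1]
    rw [← Complex.exp_add, neg_add_cancel, Complex.exp_zero]
  · refine qPochhammerInf_ne_zero hq fun k ↦ ?_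
    rw [← Complex.exp_nat_mul, ← Complex.exp_add, show 2 * Real.pi * Complex.I * (τ + z) +
      k * (2 * Real.pi * Complex.I * τ) = 2 * Real.pi * Complex.I * (z + (k + 1) * τ) by ring]
    refine aux _ fun m n hmn ↦ hz (m - (k + 1)) n ?_
    push_cast
    linear_combination hmn
  · refine qPochhammerInf_ne_zero hq fun k ↦ ?_
    rw [← Complex.exp_nat_mul, ← Complex.exp_add, show 2 * Real.pi * Complex.I * (τ - z) +
      k * (2 * Real.pi * Complex.I * τ) = 2 * Real.pi * Complex.I * (-z + (k + 1) * τ) by ring]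
    refine aux _ fun m n hmn ↦ hz (-m + (k + 1)) (-n) ?_
    push_cast
    linear_combination -hmn

/-! ### Characterisation of the theta product and its inversion formula -/

/-- Liouville's theorem for elliptic functions without poles. -/
lemma eq_const_of_doubly_periodic (τ : ℍ) {R : ℂ → ℂ} (hR : Differentiable ℂ R)
    (h1 : Function.Periodic R 1) (hτ : Function.Periodic R τ) (z : ℂ) : R z = R 0 := by
  refine hR.apply_eq_apply_of_bounded ?_ z 0
  have hc : Continuous fun x : ℝ × ℝ ↦ R (x.1 + x.2 * τ) :=
    hR.continuous.comp (by fun_prop)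
  refine ((isCompact_Icc.prod isCompact_Icc).image hc
    (s := Set.Icc (0 : ℝ) 1 ×ˢ Set.Icc (0 : ℝ) 1)).isBounded.subset ?_
  rintro _ ⟨z, rfl⟩
  set t : ℝ := z.im / τ.im with ht
  set s : ℝ := z.re - t * τ.re with hs
  have hz : z = s + t * τ := by
    apply Complex.ext
    · simp [hs]
    · simp [ht, div_mul_cancel₀ _ τ.im_ne_zero]
  refine ⟨(Int.fract s, Int.fract t), ⟨⟨Int.fract_nonneg _, (Int.fract_lt_one _).le⟩,
    Int.fract_nonneg _, (Int.fract_lt_one _).le⟩, ?_⟩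
  have e1 := (h1.int_mul ⌊s⌋).sub_eq z
  have e2 := (hτ.int_mul ⌊t⌋).sub_eq (z - ⌊s⌋ * 1)
  rw [← e1, ← e2, Int.fract, Int.fract]
  refine congrArg R ?_
  push_cast
  linear_combination -hz

/-- An entire function with the quasi-periods and the derivative at the origin of the theta product
is the theta product: the quotient of the two is an elliptic function without poles. -/
lemma eq_thetaProduct_of_quasiperiodic {τ : ℍ} {F : ℂ → ℂ} (hF : Differentiable ℂ F)
    (h1 : ∀ z, F (z + 1) = -F z)
    (hτ : ∀ z, F (z + τ) = -cexp (-(Real.pi * Complex.I * (τ + 2 * z))) * F z)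
    (h0 : F 0 = 0) (hd : HasDerivAt F (2 * Real.pi * Complex.I) 0) : F = thetaProduct τ := by
  set G := thetaProduct τ
  have hG : Differentiable ℂ G := differentiable_thetaProduct τ
  have hpi : (2 * Real.pi * Complex.I : ℂ) ≠ 0 := two_pi_I_ne_zero
  set R : ℂ → ℂ := fun z ↦ if G z = 0 then 1 else F z / G z with hRdef
  have hR1 : Function.Periodic R 1 := fun z ↦ by
    simp only [hRdef, G, h1, thetaProduct_add_one, neg_eq_zero, neg_div_neg_eq]
  have hRτ : Function.Periodic R τ := fun z ↦ by
    have he : -cexp (-(Real.pi * Complex.I * (τ + 2 * z))) ≠ 0 := neg_ne_zero.mpr (exp_ne_zero _)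
    simp only [hRdef, G, hτ, thetaProduct_add_tau, mul_eq_zero, he, false_or,
      mul_div_mul_left _ _ he]
  -- Near the origin `R` is the quotient of the difference quotients of `F` and `G`.
  have hR0 : DifferentiableAt ℂ R 0 := by
    have hF' : DifferentiableAt ℂ (dslope F 0) 0 :=
      ((differentiableOn_dslope univ_mem).mpr hF.differentiableOn).differentiableAt univ_mem
    have hG' : DifferentiableAt ℂ (dslope G 0) 0 :=
      ((differentiableOn_dslope univ_mem).mpr hG.differentiableOn).differentiableAt univ_mem
    have hFd : dslope F 0 0 = 2 * Real.pi * Complex.I := by rw [dslope_same, hd.deriv]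
    have hGd : dslope G 0 0 = 2 * Real.pi * Complex.I := by
      rw [dslope_same, (hasDerivAt_thetaProduct_zero τ).deriv]
    have hne : dslope G 0 0 ≠ 0 := hGd ▸ hpi
    refine (hF'.div hG' hne).congr_of_eventuallyEq ?_
    filter_upwards [hG'.continuousAt.eventually_ne hne] with z hz
    rcases eq_or_ne z 0 with rfl | hz0
    · rw [Pi.div_apply, hFd, hGd, div_self hpi]
      simp [hRdef, G]
    · have hGz : dslope G 0 z = G z / z := by
        simp [dslope_of_ne _ hz0, slope_def_field, G]
      have hFz : dslope F 0 z = F z / z := by simp [dslope_of_ne _ hz0, slope_def_field, h0]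
      have : G z ≠ 0 := fun h ↦ hz (by rw [hGz, h, zero_div])
      simp only [hRdef, this, if_false, Pi.div_apply, hGz, hFz]
      field_simp
  have hR : Differentiable ℂ R := fun z ↦ by
    by_cases hz : G z = 0
    · obtain ⟨m, n, rfl⟩ := exists_int_of_thetaProduct_eq_zero hz
      have hper : R = fun w ↦ R (w - (m * τ + n)) := by
        ext w
        have e1 := (hR1.int_mul n).sub_eq w
        have e2 := (hRτ.int_mul m).sub_eq (w - n * 1)
        rw [← e1, ← e2]
        ring_nf
      rw [hper]
      refine DifferentiableAt.comp (m * τ + n : ℂ) (g := R) (f := fun w : ℂ ↦ w - (m * τ + n)) ?_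
        (by fun_prop)
      simpa using hR0
    · refine ((hF z).div (hG z) hz).congr_of_eventuallyEq ?_
      filter_upwards [hG.continuous.continuousAt.eventually_ne hz] with w hw
      simp [hRdef, hw]
  have hRone (z : ℂ) : R z = 1 := by
    rw [eq_const_of_doubly_periodic τ hR hR1 hRτ z]
    simp [hRdef, G]
  have heq : ∀ z, G z ≠ 0 → F z = G z := fun z hz ↦ by
    have := hRone z
    simp only [hRdef, if_neg hz] at this
    rwa [div_eq_one_iff_eq hz] at this
  obtain ⟨z₁, hz₁⟩ : ∃ z, G z ≠ 0 := by
    by_contra! h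
    have hG0 : G = fun _ ↦ 0 := funext h
    have := (hasDerivAt_thetaProduct_zero τ).deriv
    change deriv G 0 = _ at this
    rw [hG0, deriv_const] at this
    exact hpi this.symm
  refine AnalyticOnNhd.eq_of_eventuallyEq (z₀ := z₁) (fun z _ ↦ hF.analyticAt z)
    (fun z _ ↦ hG.analyticAt z) ?_
  filter_upwards [hG.continuous.continuousAt.eventually_ne hz₁] with w hw using heq w hw

lemma thetaProduct_sub_tau (τ : ℍ) (z : ℂ) :
    thetaProduct τ (z - τ) = -cexp (Real.pi * Complex.I * (2 * z - τ)) * thetaProduct τ z := by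
  have h := thetaProduct_add_tau τ (z - τ)
  rw [sub_add_cancel] at h
  have he : cexp (Real.pi * Complex.I * (2 * z - τ)) *
      cexp (-(Real.pi * Complex.I * (τ + 2 * (z - τ)))) = 1 := by
    rw [← Complex.exp_add, Complex.exp_eq_one_iff]
    exact ⟨0, by push_cast; ring⟩
  rw [h]
  linear_combination -thetaProduct τ (z - τ) * he

/-- The inversion formula for the theta product. The right-hand side and a rescaled left-hand side
have the same quasi-periods. -/
lemma thetaProduct_S_smul (τ : ℍ) (z : ℂ) :
    thetaProduct (ModularGroup.S • τ) (z / τ) =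
      (τ : ℂ)⁻¹ * cexp (Real.pi * Complex.I * z ^ 2 / τ) * thetaProduct τ z := by
  have hτ0 : (τ : ℂ) ≠ 0 := τ.ne_zero
  have hS : ((ModularGroup.S • τ : ℍ) : ℂ) = -1 / τ := by
    rw [modular_S_smul]; simp [neg_div, inv_neg]
  set F : ℂ → ℂ := fun z ↦
    τ * cexp (-(Real.pi * Complex.I * z ^ 2 / τ)) * thetaProduct (ModularGroup.S • τ) (z / τ)
  have hE : Differentiable ℂ fun z : ℂ ↦ τ * cexp (-(Real.pi * Complex.I * z ^ 2 / τ)) := by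
    fun_prop
  have hK : Differentiable ℂ fun z : ℂ ↦ thetaProduct (ModularGroup.S • τ) (z / τ) :=
    (differentiable_thetaProduct _).comp (by fun_prop)
  have key : F = thetaProduct τ := by
    refine eq_thetaProduct_of_quasiperiodic (hE.mul hK) (fun z ↦ ?_) (fun z ↦ ?_) (by simp [F]) ?_
    · have e : (z + 1) / τ = z / τ - (ModularGroup.S • τ : ℍ) := by rw [hS]; ring
      simp only [F]
      rw [e, thetaProduct_sub_tau, hS]
      have : cexp (-(Real.pi * Complex.I * (z + 1) ^ 2 / τ)) *
          cexp (Real.pi * Complex.I * (2 * (z / τ) - -1 / τ)) =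
          cexp (-(Real.pi * Complex.I * z ^ 2 / τ)) := by
        rw [← Complex.exp_add]; ring_nf
      linear_combination -τ * thetaProduct (ModularGroup.S • τ) (z / τ) * this
    · have e : (z + τ) / τ = z / τ + 1 := by field_simp
      simp only [F]
      rw [e, thetaProduct_add_one]
      have : cexp (-(Real.pi * Complex.I * (z + τ) ^ 2 / τ)) =
          cexp (-(Real.pi * Complex.I * (τ + 2 * z))) *
            cexp (-(Real.pi * Complex.I * z ^ 2 / τ)) := by
        rw [← Complex.exp_add]; congr 1; field_simp; ring
      linear_combination -τ * thetaProduct (ModularGroup.S • τ) (z / τ) * this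
    · have hd : HasDerivAt (fun z : ℂ ↦ thetaProduct (ModularGroup.S • τ) (z / τ))
          (2 * Real.pi * Complex.I * (1 / τ)) 0 :=
        HasDerivAt.comp (h₂ := thetaProduct (ModularGroup.S • τ)) (h := fun z : ℂ ↦ z / τ) 0
          (by simpa using hasDerivAt_thetaProduct_zero _) ((hasDerivAt_id (0 : ℂ)).div_const _)
      convert! (hE 0).hasDerivAt.mul hd using 1
      simp
      field_simp
  rw [← key]
  simp only [F]
  have : cexp (Real.pi * Complex.I * z ^ 2 / τ) *
      cexp (-(Real.pi * Complex.I * z ^ 2 / τ)) = 1 := by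
    rw [← Complex.exp_add, add_neg_cancel, Complex.exp_zero]
  rw [← mul_assoc, mul_mul_mul_comm, inv_mul_cancel₀ hτ0, this, one_mul, one_mul]

lemma thetaProduct_T_smul (τ : ℍ) (z : ℂ) :
    thetaProduct (ModularGroup.T • τ) z = thetaProduct τ z := by
  have e (u : ℂ) : cexp (2 * Real.pi * Complex.I * (1 + u)) =
      cexp (2 * Real.pi * Complex.I * u) := by
    rw [← Complex.exp_periodic (2 * Real.pi * Complex.I * u)]; ring_nf
  simp only [thetaProduct, modular_T_smul, coe_vadd, ofReal_one, add_assoc, add_sub_assoc, e]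

lemma thetaProduct_add_int (τ : ℍ) (z : ℂ) (n : ℤ) :
    thetaProduct τ (z + n) = (-1) ^ n * thetaProduct τ z := by
  induction n with
  | zero => simp
  | succ n ih =>
    rw [Int.cast_add, Int.cast_one, ← add_assoc, thetaProduct_add_one, ih,
      zpow_add_one₀ (by norm_num)]
    ring
  | pred n ih =>
    have h := thetaProduct_add_one τ (z + ((-n - 1 : ℤ) : ℂ))
    rw [show z + ((-n - 1 : ℤ) : ℂ) + 1 = z + ((-n : ℤ) : ℂ) by push_cast; ring, ih] at h
    rw [zpow_sub_one₀ (by norm_num), mul_right_comm, h]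
    norm_num

lemma thetaProduct_add_int_mul_tau (τ : ℍ) (z : ℂ) (n : ℤ) :
    thetaProduct τ (z + n * τ) =
      (-1) ^ n * cexp (-(Real.pi * Complex.I * (n ^ 2 * τ + 2 * n * z))) * thetaProduct τ z := by
  induction n with
  | zero => simp
  | succ n ih =>
    rw [show z + ((n + 1 : ℤ) : ℂ) * τ = z + (n : ℤ) * τ + τ by push_cast; ring,
      thetaProduct_add_tau, ih, zpow_add_one₀ (by norm_num)]
    have : cexp (-(Real.pi * Complex.I * (((n + 1 : ℤ) : ℂ) ^ 2 * τ + 2 * ((n + 1 : ℤ) : ℂ) * z))) =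
        cexp (-(Real.pi * Complex.I * (τ + 2 * (z + (n : ℤ) * τ)))) *
        cexp (-(Real.pi * Complex.I * (((n : ℤ) : ℂ) ^ 2 * τ + 2 * ((n : ℤ) : ℂ) * z))) := by
      rw [← Complex.exp_add]; congr 1; push_cast; ring
    rw [this]
    ring
  | pred n ih =>
    rw [show z + ((-n - 1 : ℤ) : ℂ) * τ = z + ((-n : ℤ) : ℂ) * τ - τ by push_cast; ring,
      thetaProduct_sub_tau, ih, zpow_sub_one₀ (by norm_num)]
    have : cexp (-(Real.pi * Complex.I *
          (((-n - 1 : ℤ) : ℂ) ^ 2 * τ + 2 * ((-n - 1 : ℤ) : ℂ) * z))) =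
        cexp (Real.pi * Complex.I * (2 * (z + ((-n : ℤ) : ℂ) * τ) - τ)) *
        cexp (-(Real.pi * Complex.I * (((-n : ℤ) : ℂ) ^ 2 * τ + 2 * ((-n : ℤ) : ℂ) * z))) := by
      rw [← Complex.exp_add]; congr 1; push_cast; ring
    rw [this]
    norm_num
    ring

/-! ### Klein forms -/

/-- The Klein form attached to `a ∈ ℝ²`, normalised as
`exp (πi a₀ z) (w^{1/2} - w^{-1/2}) ∏_{n ≥ 1} (1 - Q^n w) (1 - Q^n w⁻¹) (1 - Q^n)⁻²`,
where `z = a₀ τ + a₁`, `w = exp (2πiz)` and `Q = exp (2πiτ)`. -/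
noncomputable def kleinForm (a : Fin 2 → ℝ) (τ : ℍ) : ℂ :=
  cexp (Real.pi * Complex.I * a 0 * (a 0 * τ + a 1)) * thetaProduct τ (a 0 * τ + a 1)

lemma kleinForm_slash_S (a : Fin 2 → ℝ) :
    kleinForm a ∣[(-1 : ℤ)] ModularGroup.S = kleinForm ![a 1, -a 0] := by
  ext τ
  have hτ0 : (τ : ℂ) ≠ 0 := τ.ne_zero
  have hS : ((ModularGroup.S • τ : ℍ) : ℂ) = -1 / τ := by
    rw [modular_S_smul]; simp [neg_div, inv_neg]
  rw [ModularForm.SL_slash_apply, ModularGroup.denom_S, neg_neg, zpow_one, kleinForm, kleinForm,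
    hS, show (a 0 : ℂ) * (-1 / τ) + a 1 = (a 1 * τ + -a 0) / τ by field_simp; ring,
    thetaProduct_S_smul]
  simp only [Matrix.cons_val_zero, Matrix.cons_val_one, ofReal_neg]
  have : cexp (Real.pi * Complex.I * a 1 * (a 1 * τ + -a 0)) =
      cexp (Real.pi * Complex.I * a 0 * ((a 1 * τ + -a 0) / τ)) *
        cexp (Real.pi * Complex.I * (a 1 * τ + -a 0) ^ 2 / τ) := by
    rw [← Complex.exp_add]; congr 1; field_simp; ring
  rw [this]
  field_simp

lemma kleinForm_slash_T (a : Fin 2 → ℝ) :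
    kleinForm a ∣[(-1 : ℤ)] ModularGroup.T = kleinForm ![a 0, a 0 + a 1] := by
  ext τ
  have hd : denom (ModularGroup.T : SL(2, ℤ)) τ = 1 := by 
    rw [ModularGroup.denom_apply]; simp [ModularGroup.T]
  rw [ModularForm.SL_slash_apply, hd, one_zpow, mul_one, kleinForm, kleinForm,
    thetaProduct_T_smul]
  simp only [Matrix.cons_val_zero, Matrix.cons_val_one, modular_T_smul, coe_vadd]
  push_cast
  ring_nf

open scoped Matrix in
lemma vecMul_map_intCast (a : Fin 2 → ℝ) (γ : SL(2, ℤ)) :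
    a ᵥ* (Matrix.SpecialLinearGroup.map (Int.castRingHom ℝ) γ).1 =
      ![a 0 * γ 0 0 + a 1 * γ 1 0, a 0 * γ 0 1 + a 1 * γ 1 1] := by
  ext i
  fin_cases i <;> simp only [Matrix.vecMul, dotProduct, Fin.sum_univ_two] <;> rfl

open scoped Matrix in
/-- The Klein forms are permuted by the weight `-1` action of `SL(2, ℤ)`, through the right action
of `SL(2, ℤ)` on row vectors. -/
lemma kleinForm_slash (γ : SL(2, ℤ)) (a : Fin 2 → ℝ) :
    kleinForm a ∣[(-1 : ℤ)] γ =
      kleinForm (a ᵥ* (Matrix.SpecialLinearGroup.map (Int.castRingHom ℝ) γ).1) := by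
  have hγ : γ ∈ Subgroup.closure {ModularGroup.S, ModularGroup.T} := by
    rw [SpecialLinearGroup.SL2Z_generators]; trivial
  induction hγ using Subgroup.closure_induction generalizing a with
  | mem x hx =>
    rcases hx with rfl | rfl
    · rw [kleinForm_slash_S, vecMul_map_intCast]
      simp [ModularGroup.S]
    · rw [kleinForm_slash_T, vecMul_map_intCast]
      simp [ModularGroup.T]
  | one => simp
  | mul x y _ _ hx hy =>
    rw [SlashAction.slash_mul, hx, hy, map_mul, Matrix.SpecialLinearGroup.coe_mul,
      Matrix.vecMul_vecMul]
  | inv x _ hx =>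
    have h := hx (a ᵥ* (Matrix.SpecialLinearGroup.map (Int.castRingHom ℝ) x⁻¹).1)
    rw [Matrix.vecMul_vecMul, ← Matrix.SpecialLinearGroup.coe_mul, ← map_mul, inv_mul_cancel,
      map_one, Matrix.SpecialLinearGroup.coe_one, Matrix.vecMul_one] at h
    rw [← h, ← SlashAction.slash_mul, mul_inv_cancel, SlashAction.slash_one]

/-- Translating `a` by an integral vector changes the Klein form by a constant, which comes from the
quasi-periods of the theta product. -/
lemma kleinForm_add_int (a : Fin 2 → ℝ) (b : Fin 2 → ℤ) (τ : ℍ) :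
    kleinForm (a + fun i ↦ (b i : ℝ)) τ =
      (-1) ^ (b 0 + b 1 + b 0 * b 1) * cexp (Real.pi * Complex.I * (a 0 * b 1 - a 1 * b 0)) *
        kleinForm a τ := by
  have e : (((a 0 + b 0 : ℝ) : ℂ) * τ + ((a 1 + b 1 : ℝ) : ℂ)) =
      (a 0 * τ + a 1 + b 0 * τ) + b 1 := by push_cast; ring
  simp only [kleinForm, Pi.add_apply]
  rw [e, thetaProduct_add_int, thetaProduct_add_int_mul_tau, zpow_add₀ (by norm_num),
    zpow_add₀ (by norm_num)]
  have hsign : ((-1 : ℂ)) ^ (b 0 * b 1) = cexp (-(Real.pi * Complex.I * (b 0 * b 1))) := by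
    rw [← exp_pi_mul_I, ← Complex.exp_int_mul, Complex.exp_eq_exp_iff_exists_int]
    exact ⟨b 0 * b 1, by push_cast; ring⟩
  have he : cexp (Real.pi * Complex.I * ((a 0 + b 0 : ℝ) : ℂ) * (a 0 * τ + a 1 + b 0 * τ + b 1)) *
      cexp (-(Real.pi * Complex.I * (b 0 ^ 2 * τ + 2 * b 0 * (a 0 * τ + a 1)))) =
      cexp (-(Real.pi * Complex.I * (b 0 * b 1))) *
      cexp (Real.pi * Complex.I * (a 0 * b 1 - a 1 * b 0)) *
      cexp (Real.pi * Complex.I * a 0 * (a 0 * τ + a 1)) *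
      cexp (2 * Real.pi * Complex.I * b 0 * b 1) := by
    simp only [← Complex.exp_add]; congr 1; push_cast; ring
  have h1 : cexp (2 * Real.pi * Complex.I * b 0 * b 1) = 1 :=
    Complex.exp_eq_one_iff.mpr ⟨b 0 * b 1, by push_cast; ring⟩
  rw [h1, mul_one] at he
  rw [hsign]
  linear_combination (-1) ^ b 0 * (-1) ^ b 1 * thetaProduct τ (a 0 * τ + a 1) * he

lemma kleinForm_ne_zero {a : Fin 2 → ℝ} (ha : ∀ b : Fin 2 → ℤ, a ≠ fun i ↦ (b i : ℝ)) (τ : ℍ) :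
    kleinForm a τ ≠ 0 := by
  refine mul_ne_zero (exp_ne_zero _) fun h ↦ ?_
  obtain ⟨m, n, hmn⟩ := exists_int_of_thetaProduct_eq_zero h
  have him := congrArg Complex.im hmn
  have hre := congrArg Complex.re hmn
  simp [τ.im_ne_zero] at him
  simp [him] at hre
  exact ha ![m, n] (by ext i; fin_cases i <;> simp [him, hre])

lemma mdifferentiable_kleinForm (a : Fin 2 → ℝ) : MDifferentiable 𝓘(ℂ) 𝓘(ℂ) (kleinForm a) := by
  rw [UpperHalfPlane.mdifferentiable_iff]
  have hq : ∀ z ∈ {z : ℂ | 0 < z.im}, ‖cexp (2 * Real.pi * Complex.I * z)‖ < 1 := fun z hz ↦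
    norm_nome_lt_one ⟨z, hz⟩
  have hU : IsOpen {z : ℂ | 0 < z.im} := isOpen_upperHalfPlaneSet
  have hp {g : ℂ → ℂ} (hg : Differentiable ℂ g) : DifferentiableOn ℂ
      (fun z ↦ qPochhammerInf (cexp (2 * Real.pi * Complex.I * g z))
        (cexp (2 * Real.pi * Complex.I * z))) {z : ℂ | 0 < z.im} :=
    DifferentiableOn.qPochhammerInf hU (by fun_prop) (by fun_prop) hq
  have key : DifferentiableOn ℂ (fun z : ℂ ↦ cexp (Real.pi * Complex.I * a 0 * (a 0 * z + a 1)) *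
      ((cexp (Real.pi * Complex.I * (a 0 * z + a 1)) -
        cexp (-(Real.pi * Complex.I * (a 0 * z + a 1)))) *
      (qPochhammerInf (cexp (2 * Real.pi * Complex.I * (z + (a 0 * z + a 1))))
          (cexp (2 * Real.pi * Complex.I * z)) *
        qPochhammerInf (cexp (2 * Real.pi * Complex.I * (z - (a 0 * z + a 1))))
          (cexp (2 * Real.pi * Complex.I * z))) /
      qPochhammerInf (cexp (2 * Real.pi * Complex.I * z)) (cexp (2 * Real.pi * Complex.I * z)) ^ 2))
      {z : ℂ | 0 < z.im} := by
    refine DifferentiableOn.mul (by fun_prop) (DifferentiableOn.div (DifferentiableOn.mul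
      (by fun_prop) ((hp (by fun_prop)).mul (hp (by fun_prop)))) ((hp (by fun_prop)).pow 2)
      fun z hz ↦ pow_ne_zero 2 (qPochhammerInf_nome_ne_zero ⟨z, hz⟩))
  refine key.congr fun z hz ↦ ?_
  simp [kleinForm, thetaProduct, ofComplex_apply_of_im_pos hz]

/-! ### Growth at infinity -/

/-- `g` has exact exponential growth: for some real `r`, the product of `|g τ|` and
`exp (r Im τ)` has a nonzero limit as `Im τ → ∞`. -/
def HasExpGrowth (g : ℍ → ℂ) : Prop :=
  ∃ r L : ℝ, L ≠ 0 ∧ Tendsto (fun τ ↦ ‖g τ‖ * Real.exp (r * τ.im)) atImInfty (𝓝 L)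

lemma HasExpGrowth.mul {f g : ℍ → ℂ} (hf : HasExpGrowth f) (hg : HasExpGrowth g) :
    HasExpGrowth fun τ ↦ f τ * g τ := by
  obtain ⟨r, L, hL, h⟩ := hf
  obtain ⟨s, M, hM, k⟩ := hg
  refine ⟨r + s, L * M, mul_ne_zero hL hM, (h.mul k).congr fun τ ↦ ?_⟩
  rw [norm_mul, add_mul, Real.exp_add]
  ring

lemma HasExpGrowth.zpow {f : ℍ → ℂ} (hf : HasExpGrowth f) (n : ℤ) :
    HasExpGrowth fun τ ↦ f τ ^ n := by
  obtain ⟨r, L, hL, h⟩ := hf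
  refine ⟨n * r, L ^ n, zpow_ne_zero n hL, (h.zpow₀ n (.inl hL)).congr fun τ ↦ ?_⟩
  rw [norm_zpow, mul_zpow, ← Real.rpow_intCast (Real.exp _), ← Real.exp_mul]
  ring_nf

lemma hasExpGrowth_const {c : ℂ} (hc : c ≠ 0) : HasExpGrowth fun _ ↦ c :=
  ⟨0, ‖c‖, norm_ne_zero_iff.mpr hc, by simp⟩

lemma HasExpGrowth.prod {ι : Type*} {s : Finset ι} {f : ι → ℍ → ℂ}
    (hf : ∀ i ∈ s, HasExpGrowth (f i)) : HasExpGrowth fun τ ↦ ∏ i ∈ s, f i τ := by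
  classical
  induction s using Finset.induction_on with
  | empty => simpa using hasExpGrowth_const one_ne_zero
  | insert i s hi ih =>
    simp only [Finset.prod_insert hi]
    exact (hf i (by simp)).mul (ih fun j hj ↦ hf j (by simp [hj]))

lemma tendsto_im_vadd_smul (s : {x : ℝ // 0 < x}) (t : ℝ) :
    Tendsto (fun τ : ℍ ↦ t +ᵥ s • τ) atImInfty atImInfty := by
  rw [atImInfty, tendsto_comap_iff]
  have : (UpperHalfPlane.im ∘ fun τ : ℍ ↦ t +ᵥ s • τ) = fun τ : ℍ ↦ (s : ℝ) * τ.im := by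
    ext τ; simp
  rw [this]
  exact tendsto_comap.const_mul_atTop s.2

lemma HasExpGrowth.comp_vadd_smul {g : ℍ → ℂ} (hg : HasExpGrowth g) (s : {x : ℝ // 0 < x})
    (t : ℝ) : HasExpGrowth fun τ ↦ g (t +ᵥ s • τ) := by
  obtain ⟨r, L, hL, h⟩ := hg
  refine ⟨r * s, L, hL, (h.comp (tendsto_im_vadd_smul s t)).congr fun τ ↦ ?_⟩
  simp [mul_assoc]

lemma tendsto_cexp_mul_add_atImInfty {c : ℝ} (hc : 0 < c) (d : ℝ) :
    Tendsto (fun τ : ℍ ↦ cexp (2 * Real.pi * Complex.I * (c * τ + d))) atImInfty (𝓝 0) := by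
  have h := (qParam_tendsto_atImInfty one_pos).comp (tendsto_im_vadd_smul ⟨c, hc⟩ d)
  refine h.congr fun τ ↦ ?_
  simp [Function.Periodic.qParam, add_comm]

lemma tendsto_nome_atImInfty :
    Tendsto (fun τ : ℍ ↦ cexp (2 * Real.pi * Complex.I * τ)) atImInfty (𝓝 0) := by
  simpa using tendsto_cexp_mul_add_atImInfty one_pos 0

lemma HasExpGrowth.cexp_mul {g : ℍ → ℂ} (hg : HasExpGrowth g) (c d : ℝ) :
    HasExpGrowth fun τ ↦ cexp (Complex.I * (c * τ + d)) * g τ := by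
  obtain ⟨r, L, hL, h⟩ := hg
  refine ⟨r + c, L, hL, h.congr fun τ ↦ ?_⟩
  rw [norm_mul, Complex.norm_exp, add_mul, Real.exp_add]
  have : (Complex.I * (c * τ + d)).re = -(c * τ.im) := by simp
  rw [this, Real.exp_neg]
  field_simp

lemma hasExpGrowth_of_tendsto {g : ℍ → ℂ} {L : ℂ} (hL : L ≠ 0) (h : Tendsto g atImInfty (𝓝 L)) :
    HasExpGrowth g :=
  ⟨0, ‖L‖, norm_ne_zero_iff.mpr hL, by simpa using h.norm⟩

/-- For `0 ≤ a₀ < 1` all factors of the product except `1 - w` tend to `1`; the factor `1 - w` tends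
to `1` if `a₀ > 0`, and is a nonzero constant if `a₀ = 0`, because then `a₁` is not an integer. -/
lemma hasExpGrowth_kleinForm_of_mem_Ico {a : Fin 2 → ℝ}
    (ha : ∀ b : Fin 2 → ℤ, a ≠ fun i ↦ (b i : ℝ)) (h0 : 0 ≤ a 0) (h1 : a 0 < 1) :
    HasExpGrowth (kleinForm a) := by
  obtain ⟨L, hL, hw⟩ : ∃ L : ℂ, L ≠ 0 ∧ Tendsto
      (fun τ : ℍ ↦ 1 - cexp (2 * Real.pi * Complex.I * (a 0 * τ + a 1))) atImInfty (𝓝 L) := by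
    rcases h0.eq_or_lt with h0 | h0
    · refine ⟨1 - cexp (2 * Real.pi * Complex.I * a 1), fun h ↦ ?_, by simp [← h0]⟩
      obtain ⟨n, hn⟩ := Complex.exp_eq_one_iff.mp (sub_eq_zero.mp h).symm
      have : (2 * Real.pi * Complex.I : ℂ) * a 1 = 2 * Real.pi * Complex.I * n := by rw [hn]; ring
      have := mul_left_cancel₀ two_pi_I_ne_zero this
      exact ha ![0, n] (by ext i; fin_cases i <;> simp [← h0]; exact_mod_cast this)
    · exact ⟨1, one_ne_zero, by simpa using (tendsto_cexp_mul_add_atImInfty h0 (a 1)).const_sub 1⟩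
  have hP1 := (tendsto_cexp_mul_add_atImInfty (c := 1 + a 0) (by linarith)
    (a 1)).qPochhammerInf_one tendsto_nome_atImInfty
  have hP2 := (tendsto_cexp_mul_add_atImInfty (c := 1 - a 0) (by linarith)
    (-a 1)).qPochhammerInf_one tendsto_nome_atImInfty
  have hP3 := tendsto_nome_atImInfty.qPochhammerInf_one tendsto_nome_atImInfty
  have hlim := (hw.mul (hP1.mul hP2)).div (hP3.pow 2) (by norm_num)
  have hg := (hasExpGrowth_of_tendsto (by simpa using hL) hlim).cexp_mul
    (Real.pi * (a 0 - 1) * a 0) (Real.pi * (a 0 - 1) * a 1)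
  have hneg := (hasExpGrowth_const (c := -1) (by norm_num)).mul hg
  convert! hneg using 2 with τ
  have e : cexp (Real.pi * Complex.I * a 0 * (a 0 * τ + a 1)) *
      (cexp (Real.pi * Complex.I * (a 0 * τ + a 1)) -
        cexp (-(Real.pi * Complex.I * (a 0 * τ + a 1)))) =
      -1 * (cexp (Complex.I * (((Real.pi * (a 0 - 1) * a 0 : ℝ) : ℂ) * τ +
        ((Real.pi * (a 0 - 1) * a 1 : ℝ) : ℂ))) *
        (1 - cexp (2 * Real.pi * Complex.I * (a 0 * τ + a 1)))) := by
    rw [mul_sub, mul_sub, ← Complex.exp_add, ← Complex.exp_add, ← Complex.exp_add]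
    push_cast
    ring_nf
  rw [kleinForm, thetaProduct, show (τ : ℂ) + (a 0 * τ + a 1) = ((1 + a 0 : ℝ) : ℂ) * τ + a 1 by
    push_cast; ring, show (τ : ℂ) - (a 0 * τ + a 1) = ((1 - a 0 : ℝ) : ℂ) * τ + ((-a 1 : ℝ) : ℂ) by
    push_cast; ring]
  simp only [Pi.div_apply]
  rw [← mul_div_assoc, ← mul_assoc, e]
  ring

lemma hasExpGrowth_kleinForm {a : Fin 2 → ℝ} (ha : ∀ b : Fin 2 → ℤ, a ≠ fun i ↦ (b i : ℝ)) :
    HasExpGrowth (kleinForm a) := by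
  set a' : Fin 2 → ℝ := ![Int.fract (a 0), a 1]
  set b : Fin 2 → ℤ := ![⌊a 0⌋, 0]
  have hab : a = a' + fun i ↦ (b i : ℝ) := by
    ext i; fin_cases i <;> simp [a', b]
  have ha' : ∀ c : Fin 2 → ℤ, a' ≠ fun i ↦ (c i : ℝ) := fun c hc ↦
    ha (c + b) (by rw [hab, hc]; ext i; simp)
  have h := hasExpGrowth_kleinForm_of_mem_Ico ha' (Int.fract_nonneg _) (Int.fract_lt_one _)
  rw [hab, funext (kleinForm_add_int a' b)]
  exact (hasExpGrowth_const (mul_ne_zero (zpow_ne_zero _ (by norm_num)) (exp_ne_zero _))).mul h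

lemma hasExpGrowth_discriminant : HasExpGrowth ModularForm.discriminant := by
  have h := (hasExpGrowth_of_tendsto one_ne_zero
    ModularForm.tendsto_atImInfty_tprod_one_sub_eta_q_pow).cexp_mul (2 * Real.pi) 0
  convert! h using 2 with τ
  rw [ModularForm.discriminant_eq_q_prod]
  simp [Function.Periodic.qParam]
  left
  ring_nf

/-! ### Generalized eta-quotients as products of Klein forms -/

lemma eta_eq_qPochhammerInf (τ : ℍ) :
    ModularForm.eta τ = cexp (2 * Real.pi * Complex.I * τ / 24) *
      qPochhammerInf (cexp (2 * Real.pi * Complex.I * τ)) (cexp (2 * Real.pi * Complex.I * τ)) := by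
  simp only [ModularForm.eta, qPochhammerInf, pow_succ',
    Function.Periodic.qParam]
  norm_num

lemma biagioliTheta_eq_kleinForm {N : ℕ} (hN : N ≠ 0) (ρ : ℤ) {z τ : ℍ} (hτ : (τ : ℂ) = N * z) :
    biagioliTheta N ρ z = -ModularForm.eta τ ^ 3 * kleinForm ![ρ / N, 0] τ := by
  have hN' : (N : ℂ) ≠ 0 := Nat.cast_ne_zero.mpr hN
  have hq := norm_nome_lt_one τ
  have e1 : cexp (2 * Real.pi * Complex.I * z) ^ ρ = cexp (2 * Real.pi * Complex.I * (ρ * z)) := by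
    rw [← Complex.exp_int_mul]; ring_nf
  have e2 : cexp (2 * Real.pi * Complex.I * z) ^ N = cexp (2 * Real.pi * Complex.I * τ) := by
    rw [← Complex.exp_nat_mul, hτ]; ring_nf
  have e3 : cexp (2 * Real.pi * Complex.I * z) ^ ((N : ℤ) - ρ) =
      cexp (2 * Real.pi * Complex.I * (τ - ρ * z)) := by
    rw [← Complex.exp_int_mul, hτ]; push_cast; ring_nf
  have e4 := qPochhammerInf_eq_mul (a := cexp (2 * Real.pi * Complex.I * (ρ * z))) hq
  rw [← Complex.exp_add, ← mul_add, add_comm (ρ * z : ℂ)] at e4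
  have e5 : (((ρ / N : ℝ) : ℂ) * τ + ((0 : ℝ) : ℂ)) = ρ * z := by
    rw [hτ]; push_cast; field_simp; ring
  have e6 : cexp (2 * Real.pi * Complex.I * z * (((N : ℂ) - 2 * ρ) ^ 2 / (8 * N))) *
      (1 - cexp (2 * Real.pi * Complex.I * (ρ * z))) =
      -(cexp (2 * Real.pi * Complex.I * τ / 24) ^ 3 *
        cexp (Real.pi * Complex.I * ((ρ / N : ℝ) : ℂ) * (ρ * z)) *
        (cexp (Real.pi * Complex.I * (ρ * z)) - cexp (-(Real.pi * Complex.I * (ρ * z))))) := by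
    rw [← Complex.exp_nat_mul, mul_sub, mul_sub, mul_one, neg_sub, ← Complex.exp_add,
      ← Complex.exp_add, ← Complex.exp_add, ← Complex.exp_add, hτ]
    congr 2 <;> (push_cast; field_simp; ring)
  have hP := qPochhammerInf_nome_ne_zero τ
  simp only [biagioliTheta, kleinForm, thetaProduct, Matrix.cons_val_zero, Matrix.cons_val_one, e1,
    e2, e3, e4, e5, eta_eq_qPochhammerInf]
  generalize qPochhammerInf (cexp (2 * Real.pi * Complex.I * τ))
    (cexp (2 * Real.pi * Complex.I * τ)) = P at hP ⊢
  have hP' : P ^ 3 * (P ^ 2)⁻¹ = P := by field_simp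
  generalize qPochhammerInf (cexp (2 * Real.pi * Complex.I * (τ + ρ * z)))
    (cexp (2 * Real.pi * Complex.I * τ)) = P₁
  generalize qPochhammerInf (cexp (2 * Real.pi * Complex.I * (τ - ρ * z)))
    (cexp (2 * Real.pi * Complex.I * τ)) = P₂
  linear_combination P₁ * P₂ * P * e6 +
    cexp (2 * Real.pi * Complex.I * τ / 24) ^ 3 *
      cexp (Real.pi * Complex.I * ((ρ / N : ℝ) : ℂ) * (ρ * z)) *
      (cexp (Real.pi * Complex.I * (ρ * z)) - cexp (-(Real.pi * Complex.I * (ρ * z)))) *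
      P₁ * P₂ * hP'

/-- The product `Δ ^ l ∏ₖ 𝔨_{v k} ^ (n k)` of powers of the discriminant and of Klein forms. -/
noncomputable def kleinProduct (l : ℤ) (s : Finset ℕ) (n : ℕ → ℤ) (v : ℕ → Fin 2 → ℝ) (τ : ℍ) : ℂ :=
  ModularForm.discriminant τ ^ l * ∏ k ∈ s, kleinForm (v k) τ ^ n k

open scoped Matrix in
lemma kleinProduct_smul (l : ℤ) (s : Finset ℕ) (n : ℕ → ℤ) (v : ℕ → Fin 2 → ℝ) (γ : SL(2, ℤ))
    (τ : ℍ) :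
    kleinProduct l s n v (γ • τ) = denom γ τ ^ (12 * l - ∑ k ∈ s, n k) * kleinProduct l s n
      (fun k ↦ v k ᵥ* (Matrix.SpecialLinearGroup.map (Int.castRingHom ℝ) γ).1) τ := by
  have hd : denom γ τ ≠ 0 := denom_ne_zero _ τ
  have hΔ : ModularForm.discriminant (γ • τ) =
      denom γ τ ^ (12 : ℤ) * ModularForm.discriminant τ := by
    have h := congrFun (SlashInvariantForm.slash_action_generators_SL2Z
      ModularForm.discriminant_S_invariant ModularForm.discriminant_T_invariant γ) τ
    rw [ModularForm.SL_slash_apply] at h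
    rw [← h, mul_left_comm, ← zpow_add₀ hd]
    simp
  have hk (k : ℕ) : kleinForm (v k) (γ • τ) = (denom γ τ)⁻¹ *
      kleinForm (v k ᵥ* (Matrix.SpecialLinearGroup.map (Int.castRingHom ℝ) γ).1) τ := by
    rw [← kleinForm_slash, ModularForm.SL_slash_apply, neg_neg, zpow_one, mul_left_comm,
      inv_mul_cancel₀ hd, mul_one]
  have hprod : ∏ k ∈ s, (denom γ τ)⁻¹ ^ n k = denom γ τ ^ (-∑ k ∈ s, n k) := by
    induction s using Finset.cons_induction with
    | empty => simp
    | cons a s ha ih =>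
      rw [Finset.prod_cons, Finset.sum_cons, ih, inv_zpow', ← zpow_add₀ hd, neg_add]
  simp only [kleinProduct, hΔ, hk, mul_zpow, Finset.prod_mul_distrib, hprod]
  rw [← zpow_mul, sub_eq_add_neg, zpow_add₀ hd]
  ring

lemma hasExpGrowth_kleinProduct (l : ℤ) (s : Finset ℕ) (n : ℕ → ℤ) {v : ℕ → Fin 2 → ℝ}
    (hv : ∀ k ∈ s, ∀ b : Fin 2 → ℤ, v k ≠ fun i ↦ (b i : ℝ)) :
    HasExpGrowth (kleinProduct l s n v) :=
  (hasExpGrowth_discriminant.zpow l).mul <| .prod fun k hk ↦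
    (hasExpGrowth_kleinForm (hv k hk)).zpow _

lemma etaThetaQuotient_eq_kleinProduct {p : ℕ} (hp : p ≠ 0) {n : ℕ → ℤ} {l : ℤ}
    (hl : n 0 + 3 * ∑ k ∈ Finset.Icc 1 ((p - 1) / 2), n k = 24 * l) {z τ : ℍ}
    (hτ : (τ : ℂ) = p * z) :
    etaThetaQuotient p n z = (-1) ^ (∑ k ∈ Finset.Icc 1 ((p - 1) / 2), n k) *
      kleinProduct l (Finset.Icc 1 ((p - 1) / 2)) n (fun k ↦ ![k / p, 0]) τ := by
  have hη : ModularForm.eta τ ≠ 0 := ModularForm.eta_ne_zero τ.2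
  have hprod (s : Finset ℕ) : ∏ k ∈ s, (-ModularForm.eta τ ^ 3) ^ n k =
      (-1) ^ (∑ k ∈ s, n k) * ModularForm.eta τ ^ (3 * ∑ k ∈ s, n k) := by
    induction s using Finset.cons_induction with
    | empty => simp
    | cons a s ha ih =>
      rw [Finset.prod_cons, Finset.sum_cons, ih, zpow_add₀ (by norm_num), mul_add, zpow_add₀ hη,
        neg_eq_neg_one_mul, mul_zpow, ← zpow_natCast, ← zpow_mul]
      push_cast
      ring
  have hf (k : ℕ) : biagioliTheta p (k : ℤ) z =
      -ModularForm.eta τ ^ 3 * kleinForm ![k / p, 0] τ := by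
    simpa using biagioliTheta_eq_kleinForm hp k hτ
  have hΔ : ModularForm.discriminant τ ^ l = ModularForm.eta τ ^ (24 * l) := by
    rw [ModularForm.discriminant, ← zpow_natCast, ← zpow_mul]; rfl
  simp only [etaThetaQuotient, kleinProduct, hf, mul_zpow, Finset.prod_mul_distrib, hprod, ← hτ, hΔ,
    ← hl, zpow_add₀ hη]
  ring

lemma mdifferentiable_kleinProduct {s : Finset ℕ} (l : ℤ) (n : ℕ → ℤ) {v : ℕ → Fin 2 → ℝ}
    (hv : ∀ k ∈ s, ∀ b : Fin 2 → ℤ, v k ≠ fun i ↦ (b i : ℝ)) :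
    MDifferentiable 𝓘(ℂ) 𝓘(ℂ) (kleinProduct l s n v) := by
  rw [UpperHalfPlane.mdifferentiable_iff]
  have hΔ : DifferentiableOn ℂ (ModularForm.discriminant ∘ ofComplex) {z : ℂ | 0 < z.im} :=
    UpperHalfPlane.mdifferentiable_iff.mp CuspForm.discriminant.holo'
  have hk (k : ℕ) : DifferentiableOn ℂ (kleinForm (v k) ∘ ofComplex) {z : ℂ | 0 < z.im} :=
    UpperHalfPlane.mdifferentiable_iff.mp (mdifferentiable_kleinForm (v k))
  exact (hΔ.zpow (.inl fun z _ ↦ ModularForm.discriminant_ne_zero _)).mul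
    (DifferentiableOn.fun_finsetProd fun k hk' ↦
      (hk k).zpow (.inl fun z _ ↦ kleinForm_ne_zero (hv k hk') _))

lemma MDifferentiable.comp_pos_smul {f : ℍ → ℂ} (hf : MDifferentiable 𝓘(ℂ) 𝓘(ℂ) f)
    (s : {x : ℝ // 0 < x}) : MDifferentiable 𝓘(ℂ) 𝓘(ℂ) fun z ↦ f (s • z) := by
  rw [UpperHalfPlane.mdifferentiable_iff] at hf ⊢
  have hs : Set.MapsTo (fun z : ℂ ↦ ((s : ℝ) : ℂ) * z) {z : ℂ | 0 < z.im} {z : ℂ | 0 < z.im} :=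
    fun z hz ↦ by simpa using mul_pos s.2 hz
  refine (hf.comp (by fun_prop) hs).congr fun z hz ↦ ?_
  simp only [Function.comp_apply]
  congr 1
  ext
  simp [ofComplex_apply_of_im_pos hz, ofComplex_apply_of_im_pos (hs hz)]

/-! ### Action of `SL(2, ℤ)` on the quotient -/

/-- If `diag(p, 1) γ = γ' (α, β; 0, δ)` then `p (γ z) = γ' ((α z + β) / δ)`. -/
lemma smul_smul_eq_smul_vadd_smul {γ γ' : SL(2, ℤ)} {p α δ : ℝ} (hp : 0 < p) (hα : 0 < α)
    (hδ : 0 < δ) {β : ℝ} (h00 : p * γ 0 0 = γ' 0 0 * α) (h01 : p * γ 0 1 = γ' 0 0 * β + γ' 0 1 * δ)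
    (h10 : (γ 1 0 : ℝ) = γ' 1 0 * α) (h11 : (γ 1 1 : ℝ) = γ' 1 0 * β + γ' 1 1 * δ) (z : ℍ) :
    (⟨p, hp⟩ : {x : ℝ // 0 < x}) • (γ • z) =
        γ' • ((β / δ) +ᵥ (⟨α / δ, div_pos hα hδ⟩ : {x : ℝ // 0 < x}) • z) ∧
      denom γ z = δ *
        denom γ' ((β / δ) +ᵥ (⟨α / δ, div_pos hα hδ⟩ : {x : ℝ // 0 < x}) • z : ℍ) := by
  set w := (β / δ) +ᵥ (⟨α / δ, div_pos hα hδ⟩ : {x : ℝ // 0 < x}) • z with hw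
  have hδ' : (δ : ℂ) ≠ 0 := ofReal_ne_zero.mpr hδ.ne'
  have hwc : (w : ℂ) * δ = α * z + β := by
    simp [hw]
    field_simp
    ring
  have h00' : (p : ℂ) * γ 0 0 = γ' 0 0 * α := mod_cast h00
  have h01' : (p : ℂ) * γ 0 1 = γ' 0 0 * β + γ' 0 1 * δ := mod_cast h01
  have h10' : (γ 1 0 : ℂ) = γ' 1 0 * α := mod_cast h10
  have h11' : (γ 1 1 : ℂ) = γ' 1 0 * β + γ' 1 1 * δ := mod_cast h11
  have hden : denom γ z = δ * denom γ' w := by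
    rw [ModularGroup.denom_apply, ModularGroup.denom_apply, h10', h11']
    linear_combination -(γ' 1 0 : ℂ) * hwc
  refine ⟨?_, hden⟩
  have hd : denom γ' w ≠ 0 := denom_ne_zero _ w
  ext
  rw [coe_pos_real_smul, UpperHalfPlane.coe_specialLinearGroup_apply,
    UpperHalfPlane.coe_specialLinearGroup_apply]
  rw [ModularGroup.denom_apply, ModularGroup.denom_apply] at hden
  rw [ModularGroup.denom_apply] at hd
  simp only [algebraMap_int_eq, eq_intCast, ofReal_intCast, real_smul]
  rw [hden, mul_div_assoc', div_eq_div_iff (mul_ne_zero hδ' hd) hd]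
  linear_combination (γ' 1 0 * w + γ' 1 1 : ℂ) * (z * h00' + h01' - γ' 0 0 * hwc)

open scoped Matrix in
/-- The weight `1` action of `γ` on the quotient, in terms of a factorisation
`diag(p, 1) γ = γ' (α, β; 0, δ)`. -/
lemma etaThetaQuotient_slash {p : ℕ} (hp : p ≠ 0) {n : ℕ → ℤ} {l : ℤ}
    (h1 : n 0 + ∑ k ∈ Finset.Icc 1 ((p - 1) / 2), n k = 2)
    (hl : n 0 + 3 * ∑ k ∈ Finset.Icc 1 ((p - 1) / 2), n k = 24 * l)
    {γ γ' : SL(2, ℤ)} {α δ : ℝ} (hα : 0 < α)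
    (hδ : 0 < δ) {β : ℝ} (h00 : (p : ℝ) * γ 0 0 = γ' 0 0 * α)
    (h01 : (p : ℝ) * γ 0 1 = γ' 0 0 * β + γ' 0 1 * δ)
    (h10 : (γ 1 0 : ℝ) = γ' 1 0 * α) (h11 : (γ 1 1 : ℝ) = γ' 1 0 * β + γ' 1 1 * δ) (z : ℍ) :
    (etaThetaQuotient p n ∣[(1 : ℤ)] γ) z =
      (δ : ℂ)⁻¹ * (-1) ^ (∑ k ∈ Finset.Icc 1 ((p - 1) / 2), n k) *
        kleinProduct l (Finset.Icc 1 ((p - 1) / 2)) n (fun k ↦ ![k / p, 0] ᵥ*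
          (Matrix.SpecialLinearGroup.map (Int.castRingHom ℝ) γ').1)
          ((β / δ) +ᵥ (⟨α / δ, div_pos hα hδ⟩ : {x : ℝ // 0 < x}) • z) := by
  have hp0 : (0 : ℝ) < p := by positivity
  obtain ⟨h, hden⟩ := smul_smul_eq_smul_vadd_smul hp0 hα hδ h00 h01 h10 h11 z
  rw [ModularForm.SL_slash_apply, etaThetaQuotient_eq_kleinProduct hp hl
    (τ := (⟨p, hp0⟩ : {x : ℝ // 0 < x}) • (γ • z)) (by simp), h, kleinProduct_smul,
    show 12 * l - ∑ k ∈ Finset.Icc 1 ((p - 1) / 2), n k = 1 by omega, hden, zpow_neg, zpow_one,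
    zpow_one]
  have hd := denom_ne_zero γ' ((β / δ) +ᵥ (⟨α / δ, div_pos hα hδ⟩ : {x : ℝ // 0 < x}) • z)
  rw [mul_inv]
  field_simp

/-- For prime `p`, every `γ` in `SL(2, ℤ)` has a factorisation
`diag(p, 1) γ = γ' (α, β; 0, δ)` with `γ'` in `SL(2, ℤ)` and `α, δ > 0`. -/
lemma exists_upperTriangular_factorisation {p : ℕ} (hp : p.Prime) (γ : SL(2, ℤ)) :
    ∃ (γ' : SL(2, ℤ)) (α β δ : ℤ), 0 < α ∧ 0 < δ ∧ p * γ 0 0 = γ' 0 0 * α ∧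
      p * γ 0 1 = γ' 0 0 * β + γ' 0 1 * δ ∧ γ 1 0 = γ' 1 0 * α ∧
      γ 1 1 = γ' 1 0 * β + γ' 1 1 * δ := by
  have hp0 : (0 : ℤ) < p := mod_cast hp.pos
  have hdet : γ 0 0 * γ 1 1 - γ 0 1 * γ 1 0 = 1 := by
    rw [← Matrix.det_fin_two, γ.det_coe]
  by_cases hc : (p : ℤ) ∣ γ 1 0
  · obtain ⟨c, hc⟩ := hc
    refine ⟨⟨!![γ 0 0, p * γ 0 1; c, γ 1 1], ?_⟩, p, 0, 1, hp0, one_pos, ?_, ?_, ?_, ?_⟩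
    · rw [Matrix.det_fin_two_of]
      linear_combination hdet + γ 0 1 * hc
    all_goals simp
    · ring
    · rw [hc]; ring
  · have hcop : IsCoprime ((p : ℤ) * γ 0 0) (γ 1 0) := by
      refine IsCoprime.mul_left ?_ ⟨γ 1 1, -γ 0 1, by linear_combination hdet⟩
      exact (Nat.prime_iff_prime_int.mp hp).coprime_iff_not_dvd.mpr hc
    obtain ⟨u, v, huv⟩ := hcop
    refine ⟨⟨!![p * γ 0 0, -v; γ 1 0, u], ?_⟩, 1, p * γ 0 1 * u + v * γ 1 1, p, one_pos, hp0,
      ?_, ?_, ?_, ?_⟩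
    · rw [Matrix.det_fin_two_of]
      linear_combination huv
    all_goals simp
    · linear_combination -(p : ℤ) * γ 0 1 * huv - p * v * hdet
    · linear_combination -γ 1 1 * huv + p * u * hdet

/-! ### Meromorphy at the cusps -/

lemma periodic_comp_ofComplex_of_vadd {f : ℍ → ℂ} {h : ℝ} (hf : ∀ τ : ℍ, f (h +ᵥ τ) = f τ) :
    Function.Periodic (f ∘ ofComplex) h := fun z ↦ by
  simp only [Function.comp_apply]
  rcases lt_or_ge 0 z.im with hz | hz
  · have hz' : 0 < (z + h).im := by simpa using hz
    rw [ofComplex_apply_of_im_pos hz, ofComplex_apply_of_im_pos hz', ← hf ⟨z, hz⟩]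
    congr 1
    ext
    simp [add_comm]
  · rw [ofComplex_apply_of_im_nonpos hz, ofComplex_apply_of_im_nonpos (by simpa using hz)]

/-- A holomorphic periodic function of exact exponential growth is meromorphic at the cusp: its
product with a large power of the local parameter is bounded. -/
lemma meromorphicAt_cuspFunction {f : ℍ → ℂ} {h : ℝ} (hh : 0 < h)
    (hper : ∀ τ : ℍ, f (h +ᵥ τ) = f τ) (hf : MDifferentiable 𝓘(ℂ) 𝓘(ℂ) f)
    (hg : HasExpGrowth f) : MeromorphicAt (cuspFunction h f) 0 := by
  obtain ⟨r, L, -, hL⟩ := hg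
  obtain ⟨N, hN⟩ := exists_nat_ge (-r * h / (2 * Real.pi))
  have hN' : 0 ≤ 2 * Real.pi * N / h + r := by
    rw [div_le_iff₀ (by positivity)] at hN
    have : -r ≤ 2 * Real.pi * N / h := by rw [le_div_iff₀ hh]; linarith
    linarith
  set F : ℍ → ℂ := fun τ ↦ Function.Periodic.qParam h τ ^ N * f τ
  have hFper : ∀ τ : ℍ, F (h +ᵥ τ) = F τ := fun τ ↦ by
    simp only [F, hper, coe_vadd]
    have : Function.Periodic.qParam h (h + τ) = Function.Periodic.qParam h τ := by
      have hh' : (h : ℂ) ≠ 0 := ofReal_ne_zero.mpr hh.ne'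
      rw [Function.Periodic.qParam, Function.Periodic.qParam,
        Complex.exp_eq_exp_iff_exists_int]
      exact ⟨1, by push_cast; field_simp; ring⟩
    rw [this]
  have hFdiff : MDifferentiable 𝓘(ℂ) 𝓘(ℂ) F := by
    rw [UpperHalfPlane.mdifferentiable_iff] at hf ⊢
    have hq : DifferentiableOn ℂ (fun z : ℂ ↦ Function.Periodic.qParam h z ^ N)
        {z : ℂ | 0 < z.im} := by fun_prop
    refine (hq.mul hf).congr fun z hz ↦ ?_
    simp [F, ofComplex_apply_of_im_pos hz]
  have hFbdd : IsBoundedAtImInfty F := by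
    have h1 : ∀ᶠ τ in atImInfty, ‖f τ‖ * Real.exp (r * τ.im) < L + 1 :=
      hL.eventually_lt_const (by simp)
    have h2 : ∀ᶠ τ : ℍ in atImInfty, 0 ≤ τ.im := tendsto_comap.eventually_ge_atTop 0
    refine Asymptotics.IsBigO.of_bound (L + 1) ?_
    filter_upwards [h1, h2] with τ hτ hτ0
    simp only [F, norm_mul, norm_pow, Function.Periodic.norm_qParam, Pi.one_apply, norm_one,
      mul_one]
    refine le_trans ?_ hτ.le
    rw [mul_comm]
    gcongr
    rw [← Real.exp_nat_mul]
    refine Real.exp_le_exp.mpr ?_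
    have := mul_nonneg hN' hτ0
    have e : (N : ℝ) * (-2 * Real.pi * (τ : ℂ).im / h) = -(2 * Real.pi * N / h * τ.im) := by
      rw [coe_im]; ring
    rw [e]
    linarith
  have hF := (analyticAt_cuspFunction_zero hh (periodic_comp_ofComplex_of_vadd hFper) hFdiff
    hFbdd).meromorphicAt
  have hid : MeromorphicAt (fun q : ℂ ↦ (q ^ N)⁻¹) 0 := ((MeromorphicAt.id 0).pow N).inv
  refine (hid.mul hF).congr ?_
  filter_upwards [self_mem_nhdsWithin, mem_nhdsWithin_of_mem_nhds
    (Metric.ball_mem_nhds (0 : ℂ) one_pos)] with q hq hq1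
  have hq0 : q ≠ 0 := hq
  set τ : ℍ := ⟨_, Function.Periodic.im_invQParam_pos_of_norm_lt_one hh (by simpa using hq1) hq0⟩
  have hqτ : Function.Periodic.qParam h τ = q := Function.Periodic.qParam_right_inv hh.ne' hq0
  have e1 := eq_cuspFunction τ hh.ne' (periodic_comp_ofComplex_of_vadd hFper)
  have e2 := eq_cuspFunction τ hh.ne' (periodic_comp_ofComplex_of_vadd hper)
  rw [hqτ] at e1 e2
  rw [Pi.mul_apply, e1, e2]
  simp only [F, hqτ]
  rw [inv_mul_cancel_left₀ (pow_ne_zero N hq0)]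

/-! ### The action of `Γ₁(p)` -/

/-- For `(a, b; c, d)` in `Γ₁(p)` with `a = 1 + p x`, the automorphy factors of the Klein forms
combine to `exp (2πi b m / p)`. -/
lemma prod_kleinForm_multipliers {s : Finset ℕ} {n : ℕ → ℤ} {p : ℕ} (hp : Odd p) {m b x : ℤ}
    (h2 : ∑ k ∈ s, (k : ℤ) ^ 2 * n k ≡ 2 * m [ZMOD (p : ℤ)]) (hxb : Even (x * (1 + b))) :
    ∏ k ∈ s, ((-1) ^ (k * x + k * b + k * x * (k * b)) *
      cexp (Real.pi * Complex.I * (k / p * (k * b)))) ^ n k =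
      cexp (2 * Real.pi * Complex.I * b * m / p) := by
  have hp0 : (p : ℂ) ≠ 0 := Nat.cast_ne_zero.mpr hp.pos.ne'
  obtain ⟨t, ht⟩ : ∃ t, ∑ k ∈ s, (k : ℤ) ^ 2 * n k = 2 * m + p * t := by
    obtain ⟨t, ht⟩ := h2.symm.dvd
    exact ⟨t, by linarith⟩
  have hprod : ∏ k ∈ s, ((-1) ^ (k * x + k * b + k * x * (k * b)) *
      cexp (Real.pi * Complex.I * (k / p * (k * b)))) ^ n k =
      cexp (Real.pi * Complex.I * ((∑ k ∈ s, (k * x + k * b + k * x * (k * b)) * n k : ℤ) +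
        b / p * (∑ k ∈ s, (k : ℤ) ^ 2 * n k : ℤ))) := by
    push_cast
    rw [Finset.mul_sum, ← Finset.sum_add_distrib, Finset.mul_sum, Complex.exp_sum]
    refine Finset.prod_congr rfl fun k _ ↦ ?_
    rw [← exp_pi_mul_I, ← Complex.exp_int_mul, ← Complex.exp_add, ← Complex.exp_int_mul]
    push_cast
    ring_nf
  -- Modulo `2`, the sign exponent is `x (1 + b) ∑ k nₖ`.
  have heven : Even (∑ k ∈ s, (k * x + k * b + k * x * (k * b)) * n k + b * t) := by
    have h2s : ∀ k : ℕ, ((k : ZMod 2)) ^ 2 = k := fun k ↦ by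
      generalize (k : ZMod 2) = y
      revert y
      decide
    have hpc : (p : ZMod 2) = 1 := by
      obtain ⟨c, rfl⟩ := hp
      push_cast
      rw [show (2 : ZMod 2) = 0 by decide]
      ring
    have h20 : (2 : ZMod 2) = 0 := by decide
    have ht' : (t : ZMod 2) = ∑ k ∈ s, (k : ZMod 2) * n k := by
      have := congrArg (Int.cast : ℤ → ZMod 2) ht
      push_cast at this
      simp only [h2s, hpc, h20] at this
      rw [this]; ring
    have hxb' : (x * (1 + b) : ZMod 2) = 0 := by
      have := (ZMod.intCast_eq_zero_iff_even (n := x * (1 + b))).mpr hxb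
      exact_mod_cast this
    rw [← ZMod.intCast_eq_zero_iff_even]
    push_cast
    have hterm : ∀ k ∈ s, ((k : ZMod 2) * x + k * b + k * x * (k * b)) * n k =
        (x + b + x * b) * (k * n k) := fun k _ ↦ by
      linear_combination (x * b * n k : ZMod 2) * h2s k
    rw [Finset.sum_congr rfl hterm, ← Finset.mul_sum, ← ht']
    linear_combination (t : ZMod 2) * hxb' + (b * t : ZMod 2) * h20
  obtain ⟨r, hr⟩ := heven
  rw [hprod, Complex.exp_eq_exp_iff_exists_int]
  refine ⟨r, ?_⟩
  have hr' : ((∑ k ∈ s, (k * x + k * b + k * x * (k * b)) * n k : ℤ) : ℂ) = r + r - b * t := by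
    rw [eq_sub_iff_add_eq]; exact_mod_cast hr
  rw [hr', ht]
  push_cast
  field_simp
  ring

lemma etaThetaQuotient_slash_of_mem_Gamma1 {p : ℕ} (hp : p ≠ 0) (hodd : Odd p) {n : ℕ → ℤ}
    {m l : ℤ} (h1 : n 0 + ∑ k ∈ Finset.Icc 1 ((p - 1) / 2), n k = 2)
    (h2 : ∑ k ∈ Finset.Icc 1 ((p - 1) / 2), (k : ℤ) ^ 2 * n k ≡ 2 * m [ZMOD (p : ℤ)])
    (hl : n 0 + 3 * ∑ k ∈ Finset.Icc 1 ((p - 1) / 2), n k = 24 * l)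
    {A : SL(2, ℤ)} (hA : A ∈ CongruenceSubgroup.Gamma1 p) (z : ℍ) :
    (etaThetaQuotient p n ∣[(1 : ℤ)] A) z =
      cexp (2 * Real.pi * Complex.I * ((A 0 1 : ℤ) : ℂ) * (m : ℂ) / (p : ℂ)) *
        etaThetaQuotient p n z := by
  obtain ⟨ha, -, hc⟩ := (CongruenceSubgroup.Gamma1_mem p A).mp hA
  obtain ⟨c, hc⟩ := (ZMod.intCast_zmod_eq_zero_iff_dvd (A 1 0) p).mp hc
  obtain ⟨x, hx⟩ : ∃ x, A 0 0 = 1 + p * x := by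
    obtain ⟨x, hx⟩ := (ZMod.intCast_eq_intCast_iff_dvd_sub 1 (A 0 0) p).mp (by simpa using ha.symm)
    exact ⟨x, by linarith⟩
  have hdet : A 0 0 * A 1 1 - A 0 1 * A 1 0 = 1 := by
    rw [← Matrix.det_fin_two, A.det_coe]
  set γ' : SL(2, ℤ) := ⟨!![A 0 0, p * A 0 1; c, A 1 1], by
    rw [Matrix.det_fin_two_of]; linear_combination hdet + A 0 1 * hc⟩ with hγ'
  have hp0 : (0 : ℝ) < p := by positivity
  have hcR : ((A 1 0 : ℤ) : ℝ) = p * c := by exact_mod_cast hc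
  have hxR : ((A 0 0 : ℤ) : ℝ) = 1 + p * x := by exact_mod_cast hx
  rw [etaThetaQuotient_slash hp h1 hl (γ' := γ') (β := 0) hp0 one_pos
    (by simp [hγ', mul_comm]) (by simp [hγ']) (by simp [hγ', hcR, mul_comm]) (by simp [hγ'])]
  set τ : ℍ := ((0 : ℝ) / 1) +ᵥ (⟨p / 1, div_pos hp0 one_pos⟩ : {x : ℝ // 0 < x}) • z with hτ
  rw [etaThetaQuotient_eq_kleinProduct hp hl (τ := τ) (by simp [hτ])]
  have hv (k : ℕ) : ![(k : ℝ) / p, 0] + (fun i ↦ ((![k * x, k * A 0 1] : Fin 2 → ℤ) i : ℝ)) =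
      Matrix.vecMul ![(k : ℝ) / p, 0] (Matrix.SpecialLinearGroup.map (Int.castRingHom ℝ) γ').1 := by
    rw [vecMul_map_intCast]
    ext i
    fin_cases i
    · simp [hγ', hxR]; field_simp
    · simp [hγ']; field_simp
  -- `a` and `b` are not both even since `a d - b c = 1`, and `a = 1 + p x` with `p` odd.
  have hxb : Even (x * (1 + A 0 1)) := by
    rw [Int.even_mul]
    by_contra! h
    have hx1 := Int.not_even_iff_odd.mp h.1
    have hb : Even (A 0 1) := by
      have := Int.not_even_iff_odd.mp h.2
      simpa [parity_simps] using this
    have hpx : Odd ((p : ℤ) * x) := ((Int.odd_coe_nat p).mpr hodd).mul hx1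
    have ha2 : Even (A 0 0) := by rw [hx]; exact odd_one.add_odd hpx
    have : Even (1 : ℤ) := hdet ▸ (ha2.mul_right _).sub (hb.mul_right _)
    simp at this
  have hprod := prod_kleinForm_multipliers hodd h2 hxb
  simp only [kleinProduct, ← hv, kleinForm_add_int, mul_zpow _ (kleinForm _ _),
    Finset.prod_mul_distrib (g := fun k ↦ kleinForm _ _ ^ n k)]
  simp only [Matrix.cons_val_zero, Matrix.cons_val_one, ofReal_zero, zero_mul, sub_zero,
    ofReal_div, ofReal_natCast, Int.cast_mul, Int.cast_natCast]
  rw [hprod]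
  simp
  ring

/-- The vectors `(k/p, 0) γ` with `0 < k < p` are not integral, so that their Klein forms have no
zeros. -/
lemma natCast_div_vecMul_ne_intCast {p k : ℕ} (hk : 0 < k) (hkp : k < p) (γ : SL(2, ℤ))
    (b : Fin 2 → ℤ) :
    Matrix.vecMul ![(k : ℝ) / p, 0] (Matrix.SpecialLinearGroup.map (Int.castRingHom ℝ) γ).1 ≠
      fun i ↦ (b i : ℝ) := by
  intro h
  have hp : (p : ℝ) ≠ 0 := Nat.cast_ne_zero.mpr (by omega)
  rw [vecMul_map_intCast] at h
  have e0 := congrFun h 0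
  have e1 := congrFun h 1
  simp only [Matrix.cons_val_zero, Matrix.cons_val_one, zero_mul, add_zero] at e0 e1
  have hdet : γ 0 0 * γ 1 1 - γ 0 1 * γ 1 0 = 1 := by
    rw [← Matrix.det_fin_two, γ.det_coe]
  have hdetR : (γ 0 0 * γ 1 1 - γ 0 1 * γ 1 0 : ℝ) = 1 := by exact_mod_cast hdet
  have hkey : (k : ℝ) = p * ((b 0 * γ 1 1 - b 1 * γ 1 0 : ℤ) : ℝ) := by
    have : (k : ℝ) / p = b 0 * γ 1 1 - b 1 * γ 1 0 := by
      rw [← e0, ← e1]; linear_combination -((k : ℝ) / p) * hdetR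
    push_cast
    rw [← this]; field_simp
  have hdvd : (p : ℤ) ∣ k := ⟨_, by exact_mod_cast hkey⟩
  have := Nat.le_of_dvd hk (Int.natCast_dvd_natCast.mp hdvd)
  omega

theorem mainTheorem5 (p : ℕ) (hp : p.Prime) (hp3 : 3 < p) (n : ℕ → ℤ) (m : ℤ)
    (h1 : n 0 + ∑ k ∈ Finset.Icc 1 ((p - 1) / 2), n k = 2)
    (h2 : ∑ k ∈ Finset.Icc 1 ((p - 1) / 2), (k : ℤ) ^ 2 * n k ≡ 2 * m [ZMOD (p : ℤ)])
    (h3 : n 0 + 3 * ∑ k ∈ Finset.Icc 1 ((p - 1) / 2), n k ≡ 0 [ZMOD 24]) :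
    IsWeaklyHolomorphicModularForm 1 (CongruenceSubgroup.Gamma p) (etaThetaQuotient p n) ∧
    ∀ A ∈ CongruenceSubgroup.Gamma1 p, ∀ z : ℍ,
      ((etaThetaQuotient p n) ∣[(1 : ℤ)] A) z =
        Complex.exp (2 * Real.pi * Complex.I * ((A 0 1 : ℤ) : ℂ) * (m : ℂ) / (p : ℂ)) *
          etaThetaQuotient p n z := by
  have hp0 : (0 : ℝ) < p := mod_cast hp.pos
  obtain ⟨l, hl⟩ := Int.modEq_zero_iff_dvd.mp h3
  have hodd : Odd p := hp.odd_of_ne_two (by omega)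
  have hΓ₁ : ∀ A ∈ CongruenceSubgroup.Gamma1 p, ∀ z : ℍ, _ := fun A hA ↦
    etaThetaQuotient_slash_of_mem_Gamma1 hp.ne_zero hodd h1 h2 hl hA
  have hv (γ : SL(2, ℤ)) : ∀ k ∈ Finset.Icc 1 ((p - 1) / 2), ∀ b : Fin 2 → ℤ,
      Matrix.vecMul ![(k : ℝ) / p, 0] (Matrix.SpecialLinearGroup.map (Int.castRingHom ℝ) γ).1 ≠
        fun i ↦ (b i : ℝ) := fun k hk ↦ by
    rw [Finset.mem_Icc] at hk
    exact natCast_div_vecMul_ne_intCast (by omega) (by omega) γ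
  have hholo : MDifferentiable 𝓘(ℂ) 𝓘(ℂ) (etaThetaQuotient p n) := by
    have hv1 : ∀ k ∈ Finset.Icc 1 ((p - 1) / 2), ∀ b : Fin 2 → ℤ,
        ![(k : ℝ) / p, 0] ≠ fun i ↦ (b i : ℝ) := by simpa using hv 1
    have h := ((mdifferentiable_kleinProduct l n hv1).comp_pos_smul ⟨p, hp0⟩).const_smul
      ((-1 : ℂ) ^ (∑ k ∈ Finset.Icc 1 ((p - 1) / 2), n k))
    convert! h using 1
    ext z
    rw [etaThetaQuotient_eq_kleinProduct hp.ne_zero hl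
      (τ := (⟨p, hp0⟩ : {x : ℝ // 0 < x}) • z) (by simp)]
    rfl
  have hΓ : ∀ γ ∈ CongruenceSubgroup.Gamma p,
      etaThetaQuotient p n ∣[(1 : ℤ)] γ = etaThetaQuotient p n := fun γ hγ ↦ by
    obtain ⟨ha, hb, hc, hd⟩ := CongruenceSubgroup.Gamma_mem.mp hγ
    obtain ⟨b, hb⟩ := (ZMod.intCast_zmod_eq_zero_iff_dvd (γ 0 1) p).mp hb
    ext z
    rw [hΓ₁ γ ((CongruenceSubgroup.Gamma1_mem p γ).mpr ⟨ha, hd, hc⟩), hb]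
    have hp0' : (p : ℂ) ≠ 0 := Nat.cast_ne_zero.mpr hp.ne_zero
    rw [Complex.exp_eq_one_iff.mpr ⟨b * m, by push_cast; field_simp⟩, one_mul]
  have hconj (γ : SL(2, ℤ)) : γ * ModularGroup.T ^ p * γ⁻¹ ∈ CongruenceSubgroup.Gamma p := by
    have hT : ModularGroup.T ^ p ∈ CongruenceSubgroup.Gamma p := by
      rw [CongruenceSubgroup.Gamma_mem, ← zpow_natCast, ModularGroup.coe_T_zpow]
      simp
    exact (CongruenceSubgroup.Gamma_normal p).conj_mem _ hT γ
  refine ⟨⟨hholo, hΓ, fun γ ↦ ⟨p, hp.pos, hconj γ, ?_⟩⟩, hΓ₁⟩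
  refine meromorphicAt_cuspFunction hp0 (fun τ ↦ ?_) (hholo.slash 1 γ) ?_
  · have hslash : (etaThetaQuotient p n ∣[(1 : ℤ)] γ) ∣[(1 : ℤ)] (ModularGroup.T ^ p) =
        etaThetaQuotient p n ∣[(1 : ℤ)] γ := by
      rw [← SlashAction.slash_mul, ← inv_mul_cancel_right (γ * ModularGroup.T ^ p) γ,
        SlashAction.slash_mul, hΓ _ (hconj γ)]
    have hden : denom (ModularGroup.T ^ p : SL(2, ℤ)) τ = 1 := by
      rw [ModularGroup.denom_apply, ← zpow_natCast, ModularGroup.coe_T_zpow]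
      simp
    have h := congrFun hslash τ
    rw [ModularForm.SL_slash_apply, hden, one_zpow, mul_one, ← zpow_natCast,
      modular_T_zpow_smul, Int.cast_natCast] at h
    exact h
  · obtain ⟨γ', α, β, δ, hα, hδ, h00, h01, h10, h11⟩ := exists_upperTriangular_factorisation hp γ
    have hα' : (0 : ℝ) < α := mod_cast hα
    have hδ' : (0 : ℝ) < δ := mod_cast hδ
    have h := (hasExpGrowth_const (c := ((δ : ℝ) : ℂ)⁻¹ *
        (-1) ^ (∑ k ∈ Finset.Icc 1 ((p - 1) / 2), n k))
      (mul_ne_zero (inv_ne_zero (ofReal_ne_zero.mpr hδ'.ne')) (zpow_ne_zero _ (by norm_num)))).mul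
      ((hasExpGrowth_kleinProduct l _ n (hv γ')).comp_vadd_smul
        ⟨α / δ, div_pos hα' hδ'⟩ (β / δ))
    convert! h using 2 with z
    exact etaThetaQuotient_slash hp.ne_zero h1 hl hα' hδ' (mod_cast h00) (mod_cast h01)
      (mod_cast h10) (mod_cast h11) z
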